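/- For $r\ge 1$, let $IR(r,\mathbb F_2)$ denote the poset, ordered by inclusion, of all subsets $E\subseteq \mathbb F_2^r\setminus\{0\}$ such that the linear matroid on $E$ (a subset of $E$ is independent if and only if it is linearly independent over $\mathbb F_2$) is a regular matroid of rank $r$. Here a finite matroid is called regular if it is represented over $\mathbb R$ by the columns of a totally unimodular matrix. Then for every $r\ge 1$ the geometric realization $|IR(r,\mathbb F_2)|$, i.e. the geometric realization of the simplicial complex whose $k$-simplices are the chains $E_0\subsetneq E_1\subsetneq\dots\subsetneq E_k$ in $IR(r,\mathbb F_2)$, is simply connected (that is, it is nonempty, path connected, and has trivial fundamental group). -/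

import Mathlib

/-! ### Linear matroids and regular matroids -/

section Matroids

variable {K V : Type*} [Field K] [AddCommGroup V] [Module K V]

/-- Augmentation for finite linearly independent sets of vectors. -/
theorem exists_insert_linearIndepOn_of_ncard_lt {I J : Set V} (hIfin : I.Finite) (hJfin : J.Finite)
    (hI : LinearIndepOn K id I) (hJ : LinearIndepOn K id J) (hIJ : I.ncard < J.ncard) :
    ∃ e ∈ J, e ∉ I ∧ LinearIndepOn K id (insert e I) := by
  by_contra! h
  have hsub : J ⊆ Submodule.span K I := by
    intro e he
    by_cases heI : e ∈ I
    · exact Submodule.subset_span heI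
    · by_contra hsp
      refine h e he heI ((linearIndepOn_insert heI).2 ⟨hI, ?_⟩)
      simpa using hsp
  have := hIfin.fintype
  have := hJfin.fintype
  have h1 : J.ncard ≤ Module.finrank K (Submodule.span K I) := by
    have hle : Submodule.span K J ≤ Submodule.span K I := Submodule.span_le.2 hsub
    have : FiniteDimensional K (Submodule.span K I) := FiniteDimensional.span_of_finite K hIfin
    have hfr := finrank_span_set_eq_card (R := K) (s := J) hJ
    rw [Set.ncard_eq_toFinset_card', ← hfr]
    exact Submodule.finrank_mono hle
  have h2 : Module.finrank K (Submodule.span K I) ≤ I.ncard := by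
    rw [Set.ncard_eq_toFinset_card']
    exact finrank_span_le_card I
  omega

/-- The linear matroid on a finite set `E` of vectors: a subset of `E` is independent
if and only if it is linearly independent over `K`. -/
noncomputable def linearMatroid (K : Type*) {V : Type*} [Field K] [AddCommGroup V] [Module K V]
    (E : Finset V) : Matroid V :=
  (IndepMatroid.ofFinite (E := (E : Set V)) E.finite_toSet
    (fun I => I ⊆ (E : Set V) ∧ LinearIndepOn K id I)
    ⟨Set.empty_subset _, linearIndepOn_empty K id⟩
    (fun _ _ hJ hIJ => ⟨hIJ.trans hJ.1, hJ.2.mono hIJ⟩)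
    (fun _ _ hI hJ hlt => by
      obtain ⟨e, heJ, heI, h⟩ := exists_insert_linearIndepOn_of_ncard_lt
        (E.finite_toSet.subset hI.1) (E.finite_toSet.subset hJ.1) hI.2 hJ.2 hlt
      exact ⟨e, heJ, heI, Set.insert_subset (hJ.1 heJ) hI.1, h⟩)
    (fun _ hI => hI.1)).matroid

theorem linearMatroid_ground (E : Finset V) : (linearMatroid K E).E = (E : Set V) := rfl

theorem linearMatroid_indep_iff (E : Finset V) (I : Set V) :
    (linearMatroid K E).Indep I ↔ I ⊆ (E : Set V) ∧ LinearIndepOn K id I := Iff.rfl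

end Matroids

/-- A map `ρ` from the ground set of `M` to a `K`-vector space represents `M` if a subset of the
ground set is independent exactly when `ρ` maps it injectively onto a linearly independent set. -/
def Matroid.IsRepresentedBy {α : Type*} (M : Matroid α) (K : Type*) {W : Type*} [Field K]
    [AddCommGroup W] [Module K W] (ρ : M.E → W) : Prop :=
  ∀ I : Set M.E, M.Indep (Subtype.val '' I) ↔ LinearIndepOn K ρ I

/-- A (finite) matroid is regular if it is represented over `ℝ` by the columns of a totally
unimodular matrix. -/
def Matroid.IsRegular {α : Type*} (M : Matroid α) : Prop :=
  ∃ (m : ℕ) (A : Matrix (Fin m) M.E ℝ), A.IsTotallyUnimodular ∧ M.IsRepresentedBy ℝ A.col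

/-! ### The poset of regular matroids in `𝔽₂ ^ r` -/

/-- The poset, ordered by inclusion, of all subsets `E` of `𝔽₂ ^ r \ {0}` whose linear matroid is
regular of rank `r`. -/
abbrev IR (r : ℕ) : Type :=
  {E : Finset (Fin r → ZMod 2) // 0 ∉ E ∧ (linearMatroid (ZMod 2) E).IsRegular ∧
    (linearMatroid (ZMod 2) E).eRank = r}

noncomputable instance (r : ℕ) : Fintype (IR r) := Fintype.ofFinite _

/-! ### Geometric realization of a finite poset -/

/-- The geometric realization of a finite poset `P`, i.e. of the simplicial complex whose simplices
are the nonempty chains of `P`. A point is given by its barycentric coordinates: a function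
`w : P → ℝ` with nonnegative values and sum `1`, whose support is a chain. As `P` is finite,
the topology is the one induced from `P → ℝ`. -/
def orderRealization (P : Type*) [PartialOrder P] [Fintype P] : Set (P → ℝ) :=
  {w | w ∈ stdSimplex ℝ P ∧ IsChain (· ≤ ·) (Function.support w)}

/-! ### Cocycles on posets -/

/-! All spanning sets of nonzero vectors form a poset `Q` with a greatest element, so its
realization is a cone. The regular ones form a lower set, because deleting columns preserves total
unimodularity. `lowerSet_induction` passes from `Q` to this lower set by removing nonregular
elements `E` one at a time, each maximal among those still present. Such an `E` is the apex of a
cone over `Q ∩ Set.Iio E`, and removing it is harmless if that base is connected and simply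
connected.

Complementation in `E` identifies this base, with order reversed, with the nonempty independent sets
of the dual matroid. Binary matroids of corank at most two are regular
(`linearMatroid_isRegular_of_encard_le`), so the dual of a nonregular one has rank at least three,
and independence complexes of such rank are simply connected (`exists_potential_of_three_le_eRank`).

Simple connectivity is handled as connectedness plus triviality of cocycles in every group.
`orderRealization.simplyConnectedSpace` returns to topology by applying this to the fundamental
group itself. -/

section Cocycles

variable {α : Type*} [PartialOrder α]

/-- Every group-valued cocycle on the comparable pairs of `s` is a coboundary. -/
def CocyclesTrivial (s : Set α) : Prop :=
  ∀ (G : Type) [Group G] (c : α → α → G),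
    (∀ x ∈ s, ∀ y ∈ s, ∀ z ∈ s, x ≤ y → y ≤ z → c x z = c x y * c y z) →
    ∃ g : α → G, ∀ x ∈ s, ∀ y ∈ s, x ≤ y → c x y = (g x)⁻¹ * g y

/-- Any two elements of `s` are connected by a zigzag of comparable elements of `s`. -/
def OrderConnected (s : Set α) : Prop :=
  ∀ f : α → Prop, (∀ x ∈ s, ∀ y ∈ s, x ≤ y → (f x ↔ f y)) → ∀ x ∈ s, ∀ y ∈ s, (f x ↔ f y)

/-- Downward induction on relative lower sets of a finite set. -/
theorem lowerSet_induction {Q D : Set α} (hQ : Q.Finite)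
    {p : Set α → Prop} (top : p Q)
    (step : ∀ (D : Set α) (E : α), D ⊆ Q → (∀ a ∈ Q, ∀ b ∈ D, a ≤ b → a ∈ D) → E ∈ Q → E ∉ D →
      Q ∩ Set.Iio E ⊆ D → p (insert E D) → p D)
    (hDQ : D ⊆ Q) (hD : ∀ a ∈ Q, ∀ b ∈ D, a ≤ b → a ∈ D) : p D := by
  induction hn : (Q \ D).ncard using Nat.strong_induction_on generalizing D with
  | _ n ih =>
    by_cases hne : (Q \ D).Nonempty
    · obtain ⟨E, hE⟩ := (hQ.subset Set.sdiff_subset).exists_minimal hne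
      have hlt : Q ∩ Set.Iio E ⊆ D := fun x hx => by
        by_contra hxD
        exact absurd (hE.2 ⟨hx.1, hxD⟩ hx.2.le) (not_le_of_gt hx.2)
      refine step D E hDQ hD hE.1.1 hE.1.2 hlt (ih _ ?_ (D := insert E D) ?_ ?_ rfl)
      · rw [← hn]
        refine Set.ncard_lt_ncard ?_ (hQ.subset Set.sdiff_subset)
        refine ⟨fun x hx => ⟨hx.1, fun h => hx.2 (Or.inr h)⟩, fun h => (h hE.1).2 (Or.inl rfl)⟩
      · exact Set.insert_subset hE.1.1 hDQ
      · rintro a ha b (rfl | hb) hab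
        · rcases hab.eq_or_lt with h | h
          · exact Or.inl h
          · exact Or.inr (hlt ⟨ha, h⟩)
        · exact Or.inr (hD a ha b hb hab)
    · have : D = Q := hDQ.antisymm fun x hx => by
        by_contra hxD
        exact hne ⟨x, hx, hxD⟩
      exact this ▸ top

theorem CocyclesTrivial.of_isGreatest {Q : Set α} {T : α} (hT : IsGreatest Q T) :
    CocyclesTrivial Q := by
  intro G _ c hc
  refine ⟨fun x => (c x T)⁻¹, fun x hx y hy hxy => ?_⟩
  simp [hc x hx y hy T hT.1 hxy (hT.2 hy)]

/-- A van Kampen argument: a cocycle on `D` is a coboundary on the link of `E`, hence extends over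
the cone with apex `E`. -/
theorem CocyclesTrivial.of_insert {Q D : Set α} {E : α} (hDQ : D ⊆ Q)
    (hD : ∀ a ∈ Q, ∀ b ∈ D, a ≤ b → a ∈ D) (hEQ : E ∈ Q) (hE : E ∉ D) (hlt : Q ∩ Set.Iio E ⊆ D)
    (hlink : CocyclesTrivial (Q ∩ Set.Iio E)) (h : CocyclesTrivial (insert E D)) :
    CocyclesTrivial D := by
  classical
  intro G _ c hc
  obtain ⟨g, hg⟩ := hlink G c fun x hx y hy z hz => hc x (hlt hx) y (hlt hy) z (hlt hz)
  have hne : ∀ x ∈ D, x ≠ E := fun x hx h => hE (h ▸ hx)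
  -- The potential `g` of the link is continued by the value `1` at `E`. Since `D` is a lower set,
  -- no pair `E ≤ y` with `y ∈ D` occurs.
  obtain ⟨g', hg'⟩ := h G (fun x y => if y = E then (if x = E then 1 else (g x)⁻¹) else c x y) (by
    have hge : ∀ y ∈ D, ¬ E ≤ y := fun y hy hEy => hE (hD E hEQ y hy hEy)
    have key : ∀ x ∈ D, ∀ y ∈ D, x ≤ y → y ≤ E → (g x)⁻¹ = c x y * (g y)⁻¹ := by
      intro x hx y hy hxy hyE
      have hy' : y < E := lt_of_le_of_ne hyE (hne y hy)
      rw [hg x ⟨hDQ hx, hxy.trans_lt hy'⟩ y ⟨hDQ hy, hy'⟩ hxy]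
      group
    rintro x (rfl | hx) y (rfl | hy) z (rfl | hz) hxy hyz
    · simp
    · exact absurd hyz (hge z hz)
    · exact absurd hxy (hge y hy)
    · exact absurd hxy (hge y hy)
    · simp
    · exact absurd hyz (hge z hz)
    · simpa [hne x hx, hne y hy] using key x hx y hy hxy hyz
    · simpa [hne y hy, hne z hz] using hc x hx y hy z hz hxy hyz)
  refine ⟨g', fun x hx y hy hxy => ?_⟩
  simpa [hne y hy] using hg' x (Or.inr hx) y (Or.inr hy) hxy

theorem OrderConnected.of_isGreatest {Q : Set α} {T : α} (hT : IsGreatest Q T) :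
    OrderConnected Q := fun _ hf x hx y hy =>
  (hf x hx T hT.1 (hT.2 hx)).trans (hf y hy T hT.1 (hT.2 hy)).symm

theorem OrderConnected.of_insert {Q D : Set α} {E : α} (hDQ : D ⊆ Q)
    (hD : ∀ a ∈ Q, ∀ b ∈ D, a ≤ b → a ∈ D) (hEQ : E ∈ Q) (hE : E ∉ D) (hlt : Q ∩ Set.Iio E ⊆ D)
    (hlink : OrderConnected (Q ∩ Set.Iio E)) (h : OrderConnected (insert E D)) :
    OrderConnected D := by
  classical
  intro f hf
  have hne : ∀ x ∈ D, x ≠ E := fun x hx h => hE (h ▸ hx)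
  have hl := hlink f fun x hx y hy => hf x (hlt hx) y (hlt hy)
  intro x hx y hy
  -- By `hl`, `f` is constant on the link; `E` receives that value.
  have := h (fun x => if x = E then ∃ z ∈ Q ∩ Set.Iio E, f z else f x) (by
    rintro x (rfl | hx) y (rfl | hy) hxy
    · simp
    · exact absurd (hD x hEQ y hy hxy) hE
    · have hx' : x ∈ Q ∩ Set.Iio y := ⟨hDQ hx, lt_of_le_of_ne hxy (hne x hx)⟩
      simp only [hne x hx, if_false, if_true]
      exact ⟨fun h => ⟨x, hx', h⟩, fun ⟨z, hz, h⟩ => (hl z hz x hx').1 h⟩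
    · simpa [hne x hx, hne y hy] using hf x hx y hy hxy) x (Or.inr hx) y (Or.inr hy)
  simpa [hne x hx, hne y hy] using this

end Cocycles

/-! ### Independence complexes of matroids -/

namespace Matroid

variable {α : Type*} {M : Matroid α}

theorem Indep.exists_insert_of_encard_lt_eRank {I : Set α} (hI : M.Indep I)
    (h : I.encard < M.eRank) : ∃ e, e ∉ I ∧ M.Indep (insert e I) := by
  obtain ⟨B, hB⟩ := M.exists_isBase
  rw [← hB.encard_eq_eRank] at h
  obtain ⟨e, he, hi⟩ := hI.augment hB.indep h
  exact ⟨e, he.2, hi⟩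

theorem Indep.pair_or_pair {e x y : α} (he : M.Indep {e}) (hxy : M.Indep {x, y})
    (hne : x ≠ y) : M.Indep {e, x} ∨ M.Indep {e, y} := by
  obtain ⟨z, hz, hi⟩ := he.augment hxy (by
    rw [Set.encard_singleton, Set.encard_pair hne]; norm_num)
  rw [Set.pair_comm] at hi
  rcases hz.1 with rfl | rfl
  · exact Or.inl hi
  · exact Or.inr hi

theorem Indep.triple_of_not_indep {a b y z : α} (hab : M.Indep {a, b}) (hne : a ≠ b)
    (h : M.Indep {b, y, z}) (hby : b ≠ y) (hbz : z ≠ b) (hyz : z ≠ y) (hy : ¬ M.Indep {a, b, y}) :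
    M.Indep {a, b, z} := by
  obtain ⟨w, hw, hi⟩ := hab.augment h (by
    rw [Set.encard_pair hne, Set.encard_eq_three.2 ⟨b, y, z, hby, hbz.symm, hyz.symm, rfl⟩]
    norm_num)
  have : insert w ({a, b} : Set α) = {a, b, w} := by ext; simp; tauto
  rw [this] at hi
  rcases hw.1 with rfl | rfl | rfl
  · exact absurd (by simp) hw.2
  · exact absurd hi hy
  · exact hi

/-- A cocycle on the 2-skeleton of the independence complex of a matroid of rank at least three
is a coboundary. -/
theorem exists_potential_of_three_le_eRank (hM : 3 ≤ M.eRank) {G : Type*} [Group G]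
    (c : α → α → G) (hc : ∀ x y z, M.Indep {x, y, z} → c x z = c x y * c y z) :
    ∃ g : α → G, ∀ x y, M.Indep {x, y} → c x y = (g x)⁻¹ * g y := by
  classical
  have hrefl : ∀ x, M.Indep {x} → c x x = 1 := fun x hx => by
    have := hc x x x (by simpa using hx)
    simpa using this
  have hsymm : ∀ x y, M.Indep {x, y} → c y x = (c x y)⁻¹ := fun x y hxy => by
    have := hc x y x (by rwa [Set.pair_comm y x, Set.insert_idem])
    rw [hrefl x (hxy.subset (by simp))] at this
    exact (inv_eq_of_mul_eq_one_right this.symm).symm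
  have hext : ∀ x y, M.Indep {x, y} → ∃ z, z ≠ x ∧ z ≠ y ∧ M.Indep {x, y, z} := by
    intro x y hxy
    have hcard : ({x, y} : Set α).encard ≤ 2 :=
      (Set.encard_insert_le _ _).trans (by rw [Set.encard_singleton]; norm_num)
    obtain ⟨z, hz, hi⟩ := hxy.exists_insert_of_encard_lt_eRank
      (hcard.trans_lt (lt_of_lt_of_le (by norm_num) hM))
    refine ⟨z, fun h => hz (by simp [h]), fun h => hz (by simp [h]), ?_⟩
    convert hi using 1
    ext; simp; tauto
  obtain ⟨e, -, he⟩ := M.empty_indep.exists_insert_of_encard_lt_eRank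
    (lt_of_lt_of_le (by simp) hM)
  simp only [insert_empty_eq] at he
  obtain ⟨z₀, hz₀e, hz₀⟩ := he.exists_insert_of_encard_lt_eRank
    (lt_of_lt_of_le (by rw [Set.encard_singleton]; norm_num) hM)
  simp only [Set.mem_singleton_iff] at hz₀e
  rw [Set.pair_comm] at hz₀
  -- If the triangle `e, x, y` is not a face, some `z` extends `{x, y}`; by exchange `e, x, z` and
  -- `e, y, z` are faces, and the three faces through `z` fill the triangle.
  have h1 : ∀ x y, M.Indep {e, x} → M.Indep {e, y} → M.Indep {x, y} →
      c x y = (c e x)⁻¹ * c e y := by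
    intro x y hx hy hxy
    by_cases hexy : M.Indep {e, x, y}
    · rw [hc e x y hexy]; group
    have hex : e ≠ x := by rintro rfl; exact hexy (by simpa using hy)
    have hey : e ≠ y := by rintro rfl; exact hexy (by simpa [Set.pair_comm x e] using hx)
    have hxy' : x ≠ y := by rintro rfl; exact hexy (by simpa using hx)
    obtain ⟨z, hzx, hzy, hz⟩ := hext x y hxy
    have hexz := hx.triple_of_not_indep hex hz hxy' hzx hzy hexy
    have heyz := hy.triple_of_not_indep hey (by rwa [Set.insert_comm]) hxy'.symm hzy hzx
      (by rwa [Set.pair_comm y x])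
    have h2 : c x y = c x z * c z y := hc x z y (by rwa [Set.pair_comm z y])
    have hyz : M.Indep {y, z} := heyz.subset (by simp)
    rw [h2, hsymm y z hyz, eq_inv_mul_of_mul_eq (hc e x z hexz).symm,
      eq_inv_mul_of_mul_eq (hc e y z heyz).symm]
    group
  have h2 : ∀ x y, M.Indep {x, y} → ¬ M.Indep {e, x} → ¬ M.Indep {e, y} → x = y := by
    intro x y hxy hx hy
    by_contra hne
    exact (he.pair_or_pair hxy hne).elim hx hy
  -- An element `x` parallel to `e` is reached through the fixed vertex `z₀`; the claim is that
  -- going on to any neighbour `y` agrees with the direct edge from `e`.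
  have h3 : ∀ x y, M.Indep {x, y} → ¬ M.Indep {e, x} → M.Indep {e, y} →
      c e z₀ * c z₀ x * c x y = c e y := by
    intro x y hxy hx hy
    have hz₀x : M.Indep {z₀, x} := by
      have := (hxy.subset (by simp) : M.Indep {x}).pair_or_pair hz₀ (Ne.symm hz₀e)
      rw [Set.pair_comm x e, Set.pair_comm x z₀] at this
      exact this.resolve_left hx
    have hne : x ≠ y := by rintro rfl; exact hx hy
    have hne' : z₀ ≠ x := by rintro rfl; exact hx hz₀
    by_cases h : M.Indep {z₀, x, y}
    · rw [mul_assoc, ← hc z₀ x y h, h1 z₀ y hz₀ hy (h.subset (by grind))]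
      group
    obtain ⟨w, hwx, hwy, hw⟩ := hext x y hxy
    have hzxw := hz₀x.triple_of_not_indep hne' hw hne hwx hwy h
    have hxw : M.Indep {x, w} := hw.subset (by grind)
    have hew : M.Indep {e, w} := by
      by_contra h'
      exact hwx (h2 x w hxw hx h').symm
    have hzx : c z₀ x = c z₀ w * c w x := hc z₀ w x (by rwa [Set.pair_comm w x])
    have hxy2 : c x y = c x w * c w y := hc x w y (by rwa [Set.pair_comm w y])
    rw [hzx, hxy2, hsymm x w hxw, h1 z₀ w hz₀ hew (hzxw.subset (by grind)),
      h1 w y hew hy (hw.subset (by grind))]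
    group
  refine ⟨fun x => if M.Indep {e, x} then c e x else c e z₀ * c z₀ x, fun x y hxy => ?_⟩
  by_cases hx : M.Indep {e, x} <;> by_cases hy : M.Indep {e, y} <;> simp only [hx, hy, if_true,
    if_false]
  · exact h1 x y hx hy hxy
  · rw [← h3 y x (by rwa [Set.pair_comm]) hy hx, hsymm x y hxy]
    group
  · rw [← h3 x y hxy hx hy]
    group
  · obtain rfl := h2 x y hxy hx hy
    rw [hrefl x (by simpa using hxy)]
    group

/-- The nonempty finite independent sets of a matroid. -/
def nonemptyIndepFinsets (M : Matroid α) : Set (Finset α) :=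
  {F | F.Nonempty ∧ M.Indep F}

/-- The face poset is the barycentric subdivision: the edge `x, y` carries the product along `{x} ≤
{x, y} ≥ {y}`, and a vertex potential extends to a face from any of its vertices. -/
theorem cocyclesTrivial_nonemptyIndepFinsets (hM : 3 ≤ M.eRank) :
    CocyclesTrivial M.nonemptyIndepFinsets := by
  classical
  intro G _ c hc
  have key : ∀ (x : α) (F F' : Finset α), x ∈ F → F ⊆ F' → M.Indep (F' : Set α) →
      c {x} F' = c {x} F * c F F' := fun x F F' hx hF hF' =>
    hc {x} ⟨Finset.singleton_nonempty x, hF'.subset (by simpa using hF hx)⟩ F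
      ⟨⟨x, hx⟩, hF'.subset (by simpa using hF)⟩ F' ⟨⟨x, hF hx⟩, hF'⟩ (by simpa using hx) hF
  obtain ⟨g, hg⟩ := exists_potential_of_three_le_eRank hM
    (fun x y => c {x} {x, y} * (c {y} {x, y})⁻¹) (by
      intro x y z h
      have h' : M.Indep (({x, y, z} : Finset α) : Set α) := by simpa using h
      rw [eq_mul_inv_of_mul_eq (key x {x, y} {x, y, z} (by simp) (by grind) h').symm,
        eq_mul_inv_of_mul_eq (key y {x, y} {x, y, z} (by simp) (by grind) h').symm,
        eq_mul_inv_of_mul_eq (key y {y, z} {x, y, z} (by simp) (by grind) h').symm,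
        eq_mul_inv_of_mul_eq (key z {y, z} {x, y, z} (by simp) (by grind) h').symm,
        eq_mul_inv_of_mul_eq (key x {x, z} {x, y, z} (by simp) (by grind) h').symm,
        eq_mul_inv_of_mul_eq (key z {x, z} {x, y, z} (by simp) (by grind) h').symm]
      group)
  have hind : ∀ F : Finset α, M.Indep (F : Set α) → ∀ x ∈ F, ∀ y ∈ F,
      g x * c {x} F = g y * c {y} F := by
    intro F hF x hx y hy
    have hs : ({x, y} : Finset α) ⊆ F := by grind
    have := hg x y (hF.subset (by simpa using Finset.coe_subset.2 hs))
    rw [key x {x, y} F (by simp) hs hF, key y {x, y} F (by simp) hs hF,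
      mul_inv_eq_iff_eq_mul.1 this]
    group
  refine ⟨fun F => if h : F.Nonempty then g h.choose * c {h.choose} F else 1,
    fun F hF F' hF' hFF' => ?_⟩
  simp only [hF.1, hF'.1, dif_pos]
  rw [hind F' hF'.2 _ hF'.1.choose_spec _ (hFF' hF.1.choose_spec),
    key _ F F' hF.1.choose_spec hFF' hF'.2]
  group

/-- Nonadjacent vertices are parallel or equal, so a neighbour of one is a neighbour of the other.
-/
theorem orderConnected_nonemptyIndepFinsets (hM : 2 ≤ M.eRank) :
    OrderConnected M.nonemptyIndepFinsets := by
  classical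
  intro f hf
  have hs : ∀ F ∈ M.nonemptyIndepFinsets, ∀ x ∈ F, (f {x} ↔ f F) := fun F hF x hx =>
    hf {x} ⟨Finset.singleton_nonempty x, hF.2.subset (by simpa using hx)⟩ F hF (by simpa using hx)
  have hp : ∀ x y, M.Indep {x, y} → (f {x} ↔ f {y}) := fun x y hxy => by
    have hmem : ({x, y} : Finset α) ∈ M.nonemptyIndepFinsets := ⟨by simp, by simpa using hxy⟩
    exact (hs _ hmem x (by simp)).trans (hs _ hmem y (by simp)).symm
  intro F hF F' hF'
  obtain ⟨x, hx⟩ := hF.1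
  obtain ⟨y, hy⟩ := hF'.1
  rw [← hs F hF x hx, ← hs F' hF' y hy]
  have hxi : M.Indep {x} := hF.2.subset (by simpa using hx)
  have hyi : M.Indep {y} := hF'.2.subset (by simpa using hy)
  by_cases hxy : M.Indep {x, y}
  · exact hp x y hxy
  obtain ⟨z, hz, hi⟩ := hxi.exists_insert_of_encard_lt_eRank
    (lt_of_lt_of_le (by rw [Set.encard_singleton]; norm_num) hM)
  have hyz : M.Indep {y, z} := (hyi.pair_or_pair hi (by simpa using hz)).resolve_right
    (by rwa [Set.pair_comm])
  rw [hp y z hyz, hp z x hi]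

end Matroid

/-! ### Paths in geometric realizations -/

section StarConvex

variable {V : Type*} [AddCommGroup V] [Module ℝ V] [TopologicalSpace V] [ContinuousAdd V]
  [ContinuousSMul ℝ V]

/-- Two paths in `X` with the same endpoints are homotopic if both of them stay in a star convex
subset of `X`. -/
theorem Path.Homotopic.of_starConvex {X S : Set V} {v : V} (hS : StarConvex ℝ v S) (hSX : S ⊆ X)
    {x y : X} (α β : Path x y) (hα : ∀ t, (α t : V) ∈ S) (hβ : ∀ t, (β t : V) ∈ S) :
    α.Homotopic β := by
  have hx : (x : V) ∈ S := by simpa using hα 0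
  have hy : (y : V) ∈ S := by simpa using hα 1
  have := hS.contractibleSpace ⟨_, hx⟩
  let lift (γ : Path x y) (hγ : ∀ t, (γ t : V) ∈ S) : Path (⟨x, hx⟩ : S) ⟨y, hy⟩ :=
    { toFun := fun t => ⟨γ t, hγ t⟩
      continuous_toFun := by fun_prop
      source' := by simp
      target' := by simp }
  exact (SimplyConnectedSpace.paths_homotopic (lift α hα) (lift β hβ)).map
    ⟨Set.inclusion hSX, continuous_inclusion hSX⟩

end StarConvex

namespace orderRealization

theorem isChain_pair_of_le {P : Type*} [PartialOrder P] {p q : P} (h : p ≤ q) :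
    IsChain (· ≤ ·) ({q, p} : Set P) := by
  rw [Set.pair_comm]
  exact IsChain.pair h

variable {P : Type} [PartialOrder P] [Fintype P]

/-- The closed star of the set of vertices `A`. -/
def star (A : Set P) : Set (P → ℝ) :=
  {w | w ∈ stdSimplex ℝ P ∧ IsChain (· ≤ ·) (Function.support w ∪ A)}

theorem star_subset (A : Set P) : star A ⊆ orderRealization P :=
  fun _ hw => ⟨hw.1, hw.2.mono Set.subset_union_left⟩

theorem star_anti {A B : Set P} (h : A ⊆ B) : star B ⊆ star A :=
  fun _ hw => ⟨hw.1, hw.2.mono (Set.union_subset_union_right _ h)⟩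

theorem support_nonempty (w : orderRealization P) : (Function.support w.1).Nonempty := by
  by_contra h
  rw [Set.not_nonempty_iff_eq_empty, Function.support_eq_empty_iff] at h
  have := w.2.1.2
  simp [h] at this

open Classical in
/-- The vertex of the realization given by an element of the poset. -/
noncomputable def vertex (p : P) : orderRealization P :=
  ⟨Pi.single p 1, single_mem_stdSimplex ℝ p,
    Set.Subsingleton.isChain (Set.subsingleton_singleton.anti Pi.support_single_subset)⟩

theorem support_vertex_subset (p : P) : Function.support (vertex p).1 ⊆ {p} := by
  classical
  convert Pi.support_single_subset (i := p) (a := (1 : ℝ))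
  simp only [vertex]

theorem vertex_mem_star {p : P} {A : Set P} (h : IsChain (· ≤ ·) (insert p A)) :
    (vertex p).1 ∈ star A := by
  refine ⟨(vertex p).2.1, h.mono (Set.union_subset ?_ (Set.subset_insert _ _))⟩
  exact (support_vertex_subset p).trans (by simp)

/-- Moving towards a vertex `p ∈ A` adds at most `p` to the support, which leaves its union with `A`
a chain. -/
theorem starConvex_star {p : P} {A : Set P} (hp : p ∈ A) :
    StarConvex ℝ (vertex p).1 (star A) := by
  intro w hw a b ha hb hab
  refine ⟨convex_stdSimplex ℝ P (vertex p).2.1 hw.1 ha hb hab, hw.2.mono ?_⟩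
  refine Set.union_subset (fun q hq => ?_) Set.subset_union_right
  by_cases hqw : q ∈ Function.support w
  · exact Or.inl hqw
  by_cases hqp : q ∈ Function.support (vertex p).1
  · exact Or.inr (by rwa [support_vertex_subset p hqp])
  · simp only [Function.mem_support, not_not] at hqw hqp
    simp [hqw, hqp] at hq

/-- The segment from a vertex to a point of its closed star. -/
noncomputable def segment (p : P) (w : orderRealization P) (h : w.1 ∈ star {p}) :
    Path (vertex p) w where
  toFun t := ⟨(1 - t.1) • (vertex p).1 + t.1 • w.1,
    star_subset {p} (starConvex_star (Set.mem_singleton p) h (sub_nonneg.2 t.2.2) t.2.1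
      (sub_add_cancel _ _))⟩
  continuous_toFun := by fun_prop
  source' := by simp
  target' := by simp

theorem segment_mem_star {p : P} {w : orderRealization P} (h : w.1 ∈ star {p}) {A : Set P}
    (hp : p ∈ A) (hw : w.1 ∈ star A) (t : unitInterval) : (segment p w h t).1 ∈ star A :=
  starConvex_star hp hw (sub_nonneg.2 t.2.2) t.2.1 (sub_add_cancel _ _)

theorem mem_star_of_mem_support {w : orderRealization P} {A : Set P}
    (h : A ⊆ Function.support w.1) : w.1 ∈ star A :=
  ⟨w.2.1, by rw [Set.union_eq_self_of_subset_right h]; exact w.2.2⟩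

theorem pathConnectedSpace [Nonempty P] (hconn : OrderConnected (Set.univ : Set P)) :
    PathConnectedSpace (orderRealization P) := by
  obtain ⟨p₀⟩ := ‹Nonempty P›
  have hv : ∀ p, Joined (vertex p₀) (vertex p) := fun p => by
    refine (hconn (fun p => Joined (vertex p₀) (vertex p)) (fun p _ q _ hpq => ?_)
      p₀ trivial p trivial).1 (Joined.refl _)
    have : Joined (vertex p) (vertex q) :=
      ⟨segment p _ (vertex_mem_star (isChain_pair_of_le hpq))⟩
    exact ⟨fun h => h.trans this, fun h => h.trans this.symm⟩
  have hw : ∀ w, Joined (vertex p₀) w := fun w => by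
    obtain ⟨p, hp⟩ := support_nonempty w
    exact (hv p).trans ⟨segment p w (mem_star_of_mem_support (by simpa using hp))⟩
  exact ⟨⟨vertex p₀⟩, fun x y => (hw x).symm.trans (hw y)⟩

/-- Both paths stay in the closed star of `p`, which is star convex. -/
theorem segment_trans_segment {p q : P} {w : orderRealization P} (hq : (vertex q).1 ∈ star {p})
    (hw : w.1 ∈ star {q}) (hpw : w.1 ∈ star {p}) (h : w.1 ∈ star {p, q}) :
    ((segment p (vertex q) hq).trans (segment q w hw)).Homotopic (segment p w hpw) := by
  refine Path.Homotopic.of_starConvex (starConvex_star (Set.mem_singleton p)) (star_subset {p})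
    _ _ (fun t => ?_)
    (segment_mem_star hpw (Set.mem_singleton p) hpw)
  have ht : ((segment p (vertex q) hq).trans (segment q w hw)) t ∈
      Set.range (segment p (vertex q) hq) ∪ Set.range (segment q w hw) := by
    rw [← Path.trans_range]
    exact ⟨t, rfl⟩
  rcases ht with ⟨s, hs⟩ | ⟨s, hs⟩
  · rw [← hs]
    exact segment_mem_star hq (Set.mem_singleton p) hq s
  · rw [← hs]
    exact star_anti (A := {p}) (B := {p, q}) (by simp) (segment_mem_star hw (by simp) h s)

/-- A potential on the vertices of the realization with values in homotopy classes of paths extends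
to the realization, which implies that all loops are contractible. -/
theorem simplyConnectedSpace_of_potential [PathConnectedSpace (orderRealization P)]
    (x₀ : orderRealization P) (b : ∀ p : P, Path.Homotopic.Quotient x₀ (vertex p))
    (hb : ∀ p q (h : (vertex q).1 ∈ star {p}), p ≤ q →
      (b p).trans (Path.Homotopic.Quotient.mk (segment p (vertex q) h)) = b q) :
    SimplyConnectedSpace (orderRealization P) := by
  have hstar : ∀ (w : orderRealization P) (p : P), p ∈ Function.support w.1 → w.1 ∈ star {p} :=
    fun w p hp => mem_star_of_mem_support (by simpa using hp)
  choose s hs using fun w : orderRealization P => support_nonempty w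
  -- The extended potential. By `hB` it does not depend on the chosen support vertex, as supports
  -- are chains.
  let B : ∀ w, Path.Homotopic.Quotient x₀ w :=
    fun w => (b (s w)).trans (Path.Homotopic.Quotient.mk (segment (s w) w (hstar w _ (hs w))))
  have hle : ∀ w p q (hp : p ∈ Function.support w.1) (hq : q ∈ Function.support w.1), p ≤ q →
      (b q).trans (Path.Homotopic.Quotient.mk (segment q w (hstar w q hq))) =
        (b p).trans (Path.Homotopic.Quotient.mk (segment p w (hstar w p hp))) := by
    intro w p q hp hq hpq
    rw [← hb p q (vertex_mem_star (isChain_pair_of_le hpq)) hpq,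
      Path.Homotopic.Quotient.trans_assoc,
      ← Path.Homotopic.Quotient.mk_trans]
    congr 1
    exact Path.Homotopic.Quotient.eq.2 (segment_trans_segment _ _ _
      (mem_star_of_mem_support (Set.insert_subset hp (by simpa using hq))))
  have hB : ∀ w p (hp : p ∈ Function.support w.1),
      B w = (b p).trans (Path.Homotopic.Quotient.mk (segment p w (hstar w p hp))) := by
    intro w p hp
    rcases w.2.2.total hp (hs w) with h | h
    · exact hle w p _ hp (hs w) h
    · exact (hle w _ p (hs w) hp h).symm
  have hlocal : ∀ (p : P) (x y : orderRealization P) (γ : Path x y),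
      (∀ t, p ∈ Function.support (γ t).1) → (B x).trans (Path.Homotopic.Quotient.mk γ) = B y := by
    intro p x y γ hγ
    have hx : p ∈ Function.support x.1 := by simpa using hγ 0
    have hy : p ∈ Function.support y.1 := by simpa using hγ 1
    rw [hB x p hx, hB y p hy, Path.Homotopic.Quotient.trans_assoc,
      ← Path.Homotopic.Quotient.mk_trans]
    congr 1
    refine Path.Homotopic.Quotient.eq.2 (Path.Homotopic.of_starConvex
      (starConvex_star (Set.mem_singleton p)) (star_subset {p}) _ _
      (fun t => ?_) (segment_mem_star _ (Set.mem_singleton p) (hstar y p hy)))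
    have ht : ((segment p x (hstar x p hx)).trans γ) t ∈
        Set.range (segment p x (hstar x p hx)) ∪ Set.range γ := by
      rw [← Path.trans_range]
      exact ⟨t, rfl⟩
    rcases ht with ⟨s, hs⟩ | ⟨s, hs⟩
    · rw [← hs]
      exact segment_mem_star _ (Set.mem_singleton p) (hstar x p hx) s
    · rw [← hs]
      exact hstar _ p (hγ s)
  have hcast : ∀ (x y x' y' : orderRealization P) (γ : Path x y) (hx : x' = x) (hy : y' = y),
      (B x').trans (Path.Homotopic.Quotient.mk (γ.cast hx hy)) = B y' →
        (B x).trans (Path.Homotopic.Quotient.mk γ) = B y := by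
    rintro x y _ _ γ rfl rfl h
    exact h
  have hglobal : ∀ (x y : orderRealization P) (γ : Path x y),
      (B x).trans (Path.Homotopic.Quotient.mk γ) = B y := by
    intro x y γ
    -- The open stars of the vertices cover the realization, so the path splits into finitely many
    -- pieces to which `hlocal` applies.
    obtain ⟨t, ht0, htmono, ⟨n, hn⟩, ht⟩ := exists_monotone_Icc_subset_open_cover_unitInterval
      (c := fun p : P => {s | 0 < (γ s).1 p})
      (fun p => isOpen_lt continuous_const
        (((continuous_apply p).comp continuous_subtype_val).comp γ.continuous))
      (fun s _ => by
        obtain ⟨p, hp⟩ := support_nonempty (γ s)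
        exact Set.mem_iUnion.2 ⟨p, lt_of_le_of_ne ((γ s).2.1.1 p) (Ne.symm hp)⟩)
    have key : ∀ k, (B (γ 0)).trans (Path.Homotopic.Quotient.mk (γ.subpath 0 (t k))) =
        B (γ (t k)) := by
      intro k
      induction k with
      | zero =>
        rw [ht0, Path.subpath_self, Path.Homotopic.Quotient.mk_refl, Path.Homotopic.Quotient.trans_refl]
      | succ k ih =>
        obtain ⟨p, hp⟩ := ht k
        rw [← Path.Homotopic.Quotient.eq.2 ⟨Path.Homotopy.subpathTransSubpath γ 0 (t k) (t (k + 1))⟩,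
          Path.Homotopic.Quotient.mk_trans, ← Path.Homotopic.Quotient.trans_assoc, ih]
        refine hlocal p _ _ _ fun u => ?_
        have hu : γ.subpath (t k) (t (k + 1)) u ∈ γ '' Set.Icc (t k) (t (k + 1)) := by
          rw [← Path.range_subpath_of_le γ _ _ (htmono k.le_succ)]
          exact ⟨u, rfl⟩
        obtain ⟨v, hv, hvu⟩ := hu
        rw [← hvu]
        exact (hp hv).ne'
    have h1 := key n
    rw [hn n le_rfl, Path.subpath_zero_one] at h1
    exact hcast _ _ _ _ γ _ _ h1
  rw [simply_connected_iff_paths_homotopic']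
  refine ⟨inferInstance, fun {x y} α β => Path.Homotopic.Quotient.eq.1 ?_⟩
  have h := (hglobal x y α).trans (hglobal x y β).symm
  have h' := congrArg (fun q => (B x).symm.trans q) h
  simpa [← Path.Homotopic.Quotient.trans_assoc] using h'

/-- The realization of a nonempty connected finite poset with trivial group-valued first cohomology
is simply connected. -/
theorem simplyConnectedSpace [Nonempty P] (hconn : OrderConnected (Set.univ : Set P))
    (hcoc : CocyclesTrivial (Set.univ : Set P)) : SimplyConnectedSpace (orderRealization P) := by
  classical
  have := pathConnectedSpace hconn
  obtain ⟨p₀⟩ := ‹Nonempty P›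
  let a : ∀ p : P, Path.Homotopic.Quotient (vertex p₀) (vertex p) :=
    fun p => Path.Homotopic.Quotient.mk (PathConnectedSpace.somePath _ _)
  -- The holonomy of the edge `p, q` along the chosen paths `a`; the default loop never occurs for
  -- `p ≤ q`.
  let l : P → P → Path.Homotopic.Quotient (vertex p₀) (vertex p₀) := fun p q =>
    if h : (vertex q).1 ∈ star {p} then
      ((a p).trans (Path.Homotopic.Quotient.mk (segment p (vertex q) h))).trans (a q).symm
    else Path.Homotopic.Quotient.refl _
  have hl : ∀ p q (h : (vertex q).1 ∈ star {p}),
      l p q = ((a p).trans (Path.Homotopic.Quotient.mk (segment p (vertex q) h))).trans (a q).symm :=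
    fun p q h => dif_pos h
  obtain ⟨g, hg⟩ := hcoc (FundamentalGroup _ (vertex p₀))
    -- The product in `FundamentalGroup` composes loops in the opposite order to `trans`; inverting
    -- restores the order of the cocycle condition.
    (fun p q => (FundamentalGroup.fromPath (l p q))⁻¹) (by
      intro p _ q _ r _ hpq hqr
      have hpqr : IsChain (· ≤ ·) ({r, p, q} : Set P) := by
        have h3 : ∀ x ∈ ({r, p, q} : Set P), ∀ y ∈ ({r, p, q} : Set P), x ≤ y ∨ y ≤ x := by
          have := hpq.trans hqr
          rintro x (rfl | rfl | rfl) y (rfl | rfl | rfl) <;> simp [*]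
        exact fun x hx y hy _ => h3 x hx y hy
      rw [← mul_inv_rev, inv_inj]
      change l p r = (l p q).trans (l q r)
      rw [hl p r (vertex_mem_star (isChain_pair_of_le (hpq.trans hqr))),
        hl p q (vertex_mem_star (isChain_pair_of_le hpq)),
        hl q r (vertex_mem_star (isChain_pair_of_le hqr)),
        ← Path.Homotopic.Quotient.eq.2 (segment_trans_segment
          (vertex_mem_star (isChain_pair_of_le hpq))
          (vertex_mem_star (isChain_pair_of_le hqr)) _ (vertex_mem_star hpqr))]
      simp only [Path.Homotopic.Quotient.trans_assoc, Path.Homotopic.Quotient.mk_trans]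
      congr 2
      simp [← Path.Homotopic.Quotient.trans_assoc])
  let g' : ∀ p : P, Path.Homotopic.Quotient (vertex p₀) (vertex p₀) := fun p => (g p).toPath
  refine simplyConnectedSpace_of_potential (vertex p₀) (fun p => (g' p).symm.trans (a p)) ?_
  intro p q h hpq
  have hgpq := congrArg (·⁻¹) (hg p trivial q trivial hpq)
  simp only [inv_inv, mul_inv_rev] at hgpq
  have h1 : l p q = (g' p).trans (g' q).symm := hgpq
  rw [hl p q h] at h1
  have h2 := congrArg (fun w => (g' p).symm.trans (w.trans (a q))) h1
  simp only [Path.Homotopic.Quotient.trans_assoc, Path.Homotopic.Quotient.symm_trans,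
    Path.Homotopic.Quotient.trans_refl] at h2
  rw [Path.Homotopic.Quotient.trans_assoc, h2, ← Path.Homotopic.Quotient.trans_assoc,
    Path.Homotopic.Quotient.symm_trans, Path.Homotopic.Quotient.refl_trans]

end orderRealization

/-! ### Totally unimodular matrices -/

namespace Matrix

variable {m n K : Type*} [Field K]

/-- Columns of a matrix are linearly independent if and only if they support a nonzero maximal
minor. -/
theorem linearIndepOn_col_iff [Fintype m] [Finite n] (A : Matrix m n K) (I : Set n) :
    LinearIndepOn K A.col I ↔ ∃ (k : ℕ) (f : Fin k → m) (g : Fin k → n), g.Injective ∧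
      Set.range g = I ∧ (A.submatrix f g).det ≠ 0 := by
  constructor
  · intro h
    let e := (Finite.equivFin I).symm
    set k := Nat.card I
    let g : Fin k → n := fun i => e i
    have hg : g.Injective := Subtype.val_injective.comp e.injective
    have hgI : Set.range g = I := by
      change Set.range (Subtype.val ∘ e) = I
      rw [e.surjective.range_comp, Subtype.range_val]
    have hrank : (A.submatrix id g).rank = k := by
      rw [← rank_transpose]
      have : LinearIndependent K (A.submatrix id g)ᵀ.row := by
        rw [← hgI, linearIndepOn_range_iff hg] at h
        exact h
      simpa using this.rank_matrix
    rw [rank_eq_finrank_span_row] at hrank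
    obtain ⟨r, hr, hli⟩ : ∃ r : Fin k → Fin k → K,
        (∀ i, r i ∈ Set.range (A.submatrix id g).row) ∧ LinearIndependent K r := by
      obtain ⟨r, hr, -, hli⟩ := Submodule.exists_fun_fin_finrank_span_eq K
        (Set.range (A.submatrix id g).row)
      exact ⟨r ∘ Fin.cast hrank.symm, fun i => hr _, hli.comp _ (Fin.cast_injective _)⟩
    choose f hf using hr
    refine ⟨k, f, g, hg, hgI, ?_⟩
    have : (A.submatrix f g).row = r := funext hf
    rw [← this, linearIndependent_rows_iff_isUnit, isUnit_iff_isUnit_det] at hli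
    exact hli.ne_zero
  · rintro ⟨k, f, g, hg, rfl, hdet⟩
    rw [linearIndepOn_range_iff hg]
    exact LinearIndependent.of_comp (LinearMap.funLeft K K f)
      (linearIndependent_cols_of_det_ne_zero hdet)

/-- Whether columns of a totally unimodular matrix are linearly independent does not depend on the
field. -/
theorem IsTotallyUnimodular.linearIndepOn_col_iff {L : Type*} [Field L] [Fintype m] [Finite n]
    {A : Matrix m n ℤ} (hA : A.IsTotallyUnimodular) (I : Set n) :
    LinearIndepOn K (A.map (fun x => (x : K))).col I ↔
      LinearIndepOn L (A.map (fun x => (x : L))).col I := by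
  have key : ∀ (k : ℕ) (f : Fin k → m) (g : Fin k → n),
      ((A.map (fun x => (x : K))).submatrix f g).det ≠ 0 ↔
        ((A.map (fun x => (x : L))).submatrix f g).det ≠ 0 := by
    intro k f g
    rw [submatrix_map, submatrix_map, ← Int.cast_det, ← Int.cast_det]
    -- Every minor is `0` or `±1`, so whether it vanishes is the same in all fields.
    obtain ⟨s, hs⟩ := (isTotallyUnimodular_iff A).1 hA k f g
    rw [← hs]
    cases s <;> simp
  simp only [Matrix.linearIndepOn_col_iff, key]

theorem IsTotallyUnimodular.map_intCast {R : Type*} [CommRing R] {A : Matrix m n ℤ}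
    (hA : A.IsTotallyUnimodular) : (A.map (fun x => (x : R))).IsTotallyUnimodular := by
  intro k f g hf hg
  obtain ⟨s, hs⟩ := hA k f g hf hg
  refine ⟨s, ?_⟩
  rw [submatrix_map, ← Int.cast_det, ← hs]
  cases s <;> simp

/-- With two columns, only minors of size at most two occur, and a 0/1 determinant of size two is
`0` or `±1`. This is where corank at most two is needed. -/
theorem isTotallyUnimodular_of_zero_one {A : Matrix m (Fin 2) ℤ}
    (hA : ∀ i j, A i j = 0 ∨ A i j = 1) :
    A.IsTotallyUnimodular := by
  intro k f g hf hg
  have hk : k ≤ 2 := by simpa using Fintype.card_le_of_injective g hg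
  interval_cases k
  · exact ⟨1, by simp⟩
  · rw [det_fin_one]
    rcases hA (f 0) (g 0) with h | h
    · exact ⟨0, by simp [h]⟩
    · exact ⟨1, by simp [h]⟩
  · rw [det_fin_two]
    simp only [submatrix_apply]
    have hd : A (f 0) (g 0) * A (f 1) (g 1) - A (f 0) (g 1) * A (f 1) (g 0) ∈
        ({0, 1, -1} : Set ℤ) := by
      rcases hA (f 0) (g 0) with h | h <;> rcases hA (f 0) (g 1) with h' | h' <;>
        rcases hA (f 1) (g 0) with h'' | h'' <;> rcases hA (f 1) (g 1) with h''' | h''' <;>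
        simp [h, h', h'', h''']
    rcases hd with h | h | h
    · exact ⟨0, by simp [h]⟩
    · exact ⟨1, by simp [h]⟩
    · exact ⟨-1, by simp [Set.mem_singleton_iff.1 h]⟩

end Matrix

/-! ### Binary matroids of corank at most two -/

theorem Matroid.IsRegular.of_int {α : Type*} {M : Matroid α} [Finite M.E] {m : ℕ}
    {A : Matrix (Fin m) M.E ℤ} (hA : A.IsTotallyUnimodular) {K : Type*} [Field K]
    (h : M.IsRepresentedBy K (A.map (fun x => (x : K))).col) : M.IsRegular :=
  ⟨m, _, hA.map_intCast, fun I => (h I).trans (hA.linearIndepOn_col_iff I)⟩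

theorem Set.exists_subset_range_of_encard_le_two {α : Type*} [Nonempty α] {s : Set α}
    (h : s.encard ≤ 2) : ∃ u : Fin 2 → α, s ⊆ Set.range u := by
  obtain ⟨a⟩ := ‹Nonempty α›
  have hs : s.Finite := Set.finite_of_encard_le_coe h
  rcases s.eq_empty_or_nonempty with rfl | ⟨x, hx⟩
  · exact ⟨fun _ => a, Set.empty_subset _⟩
  have h1 : (s \ {x}).encard ≤ 1 := by
    have := Set.encard_sdiff_singleton_add_one hx
    rw [← this] at h
    exact (ENat.add_le_add_iff_right (by simp)).1 (h.trans (by norm_num))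
  rw [Set.encard_le_one_iff] at h1
  by_cases hy : ∃ y, y ∈ s \ {x}
  · obtain ⟨y, hy⟩ := hy
    refine ⟨![x, y], fun z hz => ?_⟩
    by_cases hzx : z = x
    · exact ⟨0, by simp [hzx]⟩
    · exact ⟨1, by simp [h1 z y ⟨hz, hzx⟩ hy]⟩
  · refine ⟨fun _ => x, fun z hz => ⟨0, ?_⟩⟩
    by_contra hzx
    exact hy ⟨z, hz, fun h => hzx h.symm⟩

theorem linearMatroid_finite {K V : Type*} [Field K] [AddCommGroup V] [Module K V] (E : Finset V) :
    Finite (linearMatroid K E).E := E.finite_toSet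

theorem linearMatroid_isRepresentedBy_iff {K V W : Type*} [Field K] [AddCommGroup V] [Module K V]
    [AddCommGroup W] [Module K W] (E : Finset V) (L : W →ₗ[K] V) (hL : Function.Injective L)
    {ρ : (linearMatroid K E).E → W} (hρ : ∀ e, L (ρ e) = e) :
    (linearMatroid K E).IsRepresentedBy K ρ := by
  intro I
  rw [linearMatroid_indep_iff, and_iff_right (by rintro _ ⟨x, -, rfl⟩; exact x.2),
    ← linearIndepOn_iff_image Subtype.val_injective.injOn,
    ← L.linearIndepOn_iff_of_injOn hL.injOn]
  have : L ∘ ρ = Subtype.val := funext hρ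
  rw [this]

/-- Binary matroids of corank at most two are regular. -/
theorem linearMatroid_isRegular_of_encard_le {V : Type*} [AddCommGroup V] [Module (ZMod 2) V]
    (E : Finset V) (hE : (E : Set V).encard ≤ (linearMatroid (ZMod 2) E).eRank + 2) :
    (linearMatroid (ZMod 2) E).IsRegular := by
  classical
  have := linearMatroid_finite (K := ZMod 2) E
  obtain ⟨B, hB⟩ := (linearMatroid (ZMod 2) E).exists_isBase
  have hBE : B ⊆ (E : Set V) := hB.subset_ground
  have hBfin : B.Finite := E.finite_toSet.subset hBE
  have hBli : LinearIndepOn (ZMod 2) id B := ((linearMatroid_indep_iff E B).1 hB.indep).2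
  have hspan : ∀ e ∈ E, e ∈ Submodule.span (ZMod 2) B := by
    intro e he
    by_contra hsp
    by_cases heB : e ∈ B
    · exact hsp (Submodule.subset_span heB)
    · refine (hB.insert_dep ⟨he, heB⟩).not_indep ?_
      exact (linearMatroid_indep_iff E _).2
        ⟨Set.insert_subset he hBE, (linearIndepOn_insert heB).2 ⟨hBli, by simpa using hsp⟩⟩
  have hcard : ((E : Set V) \ B).encard ≤ 2 := by
    rw [← hB.encard_eq_eRank, ← Set.encard_sdiff_add_encard_of_subset hBE, add_comm] at hE
    exact (ENat.add_le_add_iff_left hBfin.encard_lt_top.ne).1 hE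
  obtain ⟨u, hu⟩ := Set.exists_subset_range_of_encard_le_two hcard
  have := hBfin.to_subtype
  let b := (Finite.equivFin B).symm
  set m := Nat.card B
  let L := Fintype.linearCombination (ZMod 2) (fun i : Fin m => (b i : V))
  have hL : Function.Injective L := by
    refine LinearIndependent.fintypeLinearCombination_injective ?_
    exact LinearIndependent.comp hBli b b.injective
  have hLsingle : ∀ i, L (Pi.single i 1) = b i := fun i => by
    simp [L, Fintype.linearCombination_apply_single]
  have hLspan : ∀ e ∈ E, ∃ y, L y = e := by
    intro e he
    have hr : Set.range (fun i : Fin m => (b i : V)) = B := by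
      change Set.range (Subtype.val ∘ b) = B
      rw [b.surjective.range_comp, Subtype.range_val]
    have := hspan e he
    rw [← hr, Submodule.mem_span_range_iff_exists_fun] at this
    exact this
  have hy : ∀ k, ∃ y, u k ∈ E → L y = u k := fun k => by
    by_cases hk : u k ∈ E
    · exact (hLspan _ hk).imp fun _ h _ => h
    · exact ⟨0, fun h => absurd h hk⟩
  choose y hy using hy
  -- The standard form of the representation: an identity block for the base `B`, then the
  -- coordinates of the at most two other elements, lifted to the integers `0` and `1`.
  let A : Matrix (Fin m) (Fin m ⊕ Fin 2) ℤ :=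
    Matrix.fromCols 1 (Matrix.of fun i k => ((y k i).val : ℤ))
  have hA : A.IsTotallyUnimodular := by
    refine (Matrix.one_fromCols_isTotallyUnimodular_iff _).2
      (Matrix.isTotallyUnimodular_of_zero_one ?_)
    intro i k
    have := (y k i).val_lt
    simp only [Matrix.of_apply]
    omega
  have hj : ∀ e : (linearMatroid (ZMod 2) E).E, ∃ j,
      L ((A.map (fun x => (x : ZMod 2))).col j) = e := by
    rintro ⟨e, he⟩
    by_cases heB : e ∈ B
    · obtain ⟨i, hi⟩ := b.surjective ⟨e, heB⟩
      refine ⟨Sum.inl i, ?_⟩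
      have : (A.map (fun x => (x : ZMod 2))).col (Sum.inl i) = Pi.single i 1 := by
        ext k
        simp [A, Matrix.col, Matrix.one_apply, Pi.single_apply]
      rw [this, hLsingle, hi]
    · obtain ⟨k, hk⟩ := hu ⟨he, heB⟩
      refine ⟨Sum.inr k, ?_⟩
      have : (A.map (fun x => (x : ZMod 2))).col (Sum.inr k) = y k := by
        ext i
        simp [A, Matrix.col]
      rw [this, hy k (hk ▸ he), hk]
  choose j hj using hj
  exact Matroid.IsRegular.of_int (hA.submatrix id j)
    (linearMatroid_isRepresentedBy_iff E L hL hj)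

theorem Matroid.IsRegular.linearMatroid_mono {K V : Type*} [Field K] [AddCommGroup V] [Module K V]
    {S E : Finset V} (hSE : S ⊆ E) (hE : (linearMatroid K E).IsRegular) :
    (linearMatroid K S).IsRegular := by
  obtain ⟨m, A, hA, hrep⟩ := hE
  let ι : (linearMatroid K S).E → (linearMatroid K E).E := Set.inclusion hSE
  have hι : ι.Injective := Set.inclusion_injective hSE
  refine ⟨m, A.submatrix id ι, hA.submatrix id ι, fun I => ?_⟩
  have h := hrep (ι '' I)
  rw [linearMatroid_indep_iff, and_iff_right (by rintro _ ⟨x, -, rfl⟩; exact x.2)] at h ⊢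
  have himg : Subtype.val '' (ι '' I) = Subtype.val '' I := by
    rw [Set.image_image]
  rw [← himg, h]
  refine ⟨fun h => h.comp_of_image hι.injOn, fun h => LinearIndepOn.image_of_comp ι _ h⟩

/-! ### Lower links in the poset of spanning sets -/

section Transport

variable {α β : Type*} [PartialOrder α] [PartialOrder β]

/-- Inverting the values of a cocycle gives a cocycle for the reversed order. -/
theorem CocyclesTrivial.of_antitone {s : Set α} {t : Set β} (h : CocyclesTrivial t) (φ : α → β)
    (ψ : β → α) (hφ : Set.MapsTo φ s t) (hψ : Set.MapsTo ψ t s) (hφa : AntitoneOn φ s)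
    (hψa : AntitoneOn ψ t) (hψφ : ∀ x ∈ s, ψ (φ x) = x) : CocyclesTrivial s := by
  intro G _ c hc
  obtain ⟨g, hg⟩ := h G (fun x y => (c (ψ y) (ψ x))⁻¹) (by
    intro x hx y hy z hz hxy hyz
    rw [hc _ (hψ hz) _ (hψ hy) _ (hψ hx) (hψa hy hz hyz) (hψa hx hy hxy), mul_inv_rev])
  refine ⟨fun x => g (φ x), fun x hx y hy hxy => ?_⟩
  have := hg _ (hφ hy) _ (hφ hx) (hφa hx hy hxy)
  rw [hψφ x hx, hψφ y hy] at this
  rw [← inv_inv (c x y), this]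
  group

theorem OrderConnected.of_antitone {s : Set α} {t : Set β} (h : OrderConnected t) (φ : α → β)
    (ψ : β → α) (hφ : Set.MapsTo φ s t) (hψ : Set.MapsTo ψ t s)
    (hψa : AntitoneOn ψ t) (hψφ : ∀ x ∈ s, ψ (φ x) = x) : OrderConnected s := by
  intro f hf x hx y hy
  have := h (f ∘ ψ) (fun x hx y hy hxy => (hf _ (hψ hy) _ (hψ hx) (hψa hx hy hxy)).symm)
    _ (hφ hx) _ (hφ hy)
  simpa [hψφ x hx, hψφ y hy] using this

theorem CocyclesTrivial.univ_subtype {p : α → Prop} (h : CocyclesTrivial {x | p x}) :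
    CocyclesTrivial (Set.univ : Set {x // p x}) := by
  classical
  intro G _ c hc
  obtain ⟨g, hg⟩ := h G (fun x y => if h : p x ∧ p y then c ⟨x, h.1⟩ ⟨y, h.2⟩ else 1) (by
    intro x hx y hy z hz hxy hyz
    simp only [Set.mem_ofPred_eq] at hx hy hz
    simpa [hx, hy, hz] using hc ⟨x, hx⟩ trivial ⟨y, hy⟩ trivial ⟨z, hz⟩ trivial hxy hyz)
  refine ⟨fun x => g x, fun x _ y _ hxy => ?_⟩
  simpa [x.2, y.2] using hg x x.2 y y.2 hxy

theorem OrderConnected.univ_subtype {p : α → Prop} (h : OrderConnected {x | p x}) :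
    OrderConnected (Set.univ : Set {x // p x}) := by
  intro f hf x _ y _
  have := h (fun x => ∃ h : p x, f ⟨x, h⟩) (fun x hx y hy hxy =>
    ⟨fun ⟨_, h⟩ => ⟨hy, (hf ⟨x, hx⟩ trivial ⟨y, hy⟩ trivial hxy).1 h⟩,
      fun ⟨_, h⟩ => ⟨hx, (hf ⟨x, hx⟩ trivial ⟨y, hy⟩ trivial hxy).2 h⟩⟩) x x.2 y y.2
  simpa [x.2, y.2] using this

end Transport

section LinearMatroid

variable {K V : Type*} [Field K] [AddCommGroup V] [Module K V]

theorem linearMatroid_restrict {S E : Finset V} (h : S ⊆ E) :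
    (linearMatroid K E).restrict S = linearMatroid K S := by
  refine Matroid.ext_indep rfl fun I hI => ?_
  have hIS : I ⊆ (S : Set V) := hI
  rw [Matroid.restrict_indep_iff, linearMatroid_indep_iff, linearMatroid_indep_iff]
  have := hIS.trans (Finset.coe_subset.2 h)
  tauto

instance (E : Finset V) : (linearMatroid K E).Finite := ⟨E.finite_toSet⟩

theorem linearMatroid_spanning_iff {S E : Finset V} (h : S ⊆ E) :
    (linearMatroid K E).Spanning S ↔
      (linearMatroid K S).eRank = (linearMatroid K E).eRank := by
  rw [Matroid.spanning_iff_eRk_le (by simpa [linearMatroid_ground] using h),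
    ← linearMatroid_restrict h, Matroid.eRank_restrict]
  exact ⟨fun h => (Matroid.eRk_le_eRank _ _).antisymm h, fun h => h.ge⟩

variable [DecidableEq V]

/-- A set is independent in the dual exactly when its complement spans. -/
theorem sdiff_mem_nonemptyIndepFinsets_iff {S E : Finset V} (h : S ⊆ E) :
    E \ S ∈ (linearMatroid K E)✶.nonemptyIndepFinsets ↔
      S ≠ E ∧ (linearMatroid K S).eRank = (linearMatroid K E).eRank := by
  refine and_congr ?_ ?_
  · rw [Finset.sdiff_nonempty]
    exact ⟨fun h' he => h' he.ge, fun h' he => h' (h.antisymm he)⟩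
  · rw [← linearMatroid_spanning_iff h, ← Matroid.coindep_def, Matroid.coindep_iff_compl_spanning
      (by rw [linearMatroid_ground]; simp), linearMatroid_ground, ← Finset.coe_sdiff,
      Finset.sdiff_sdiff_eq_self h]

/-- The sets of nonzero vectors of rank `ρ`. -/
def spanningFinsets (K V : Type*) [Field K] [AddCommGroup V] [Module K V] (ρ : ℕ∞) :
    Set (Finset V) :=
  {E | 0 ∉ E ∧ (linearMatroid K E).eRank = ρ}

theorem mapsTo_sdiff_spanningFinsets {ρ : ℕ∞} {E : Finset V} (hE : E ∈ spanningFinsets K V ρ) :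
    Set.MapsTo (E \ ·) (spanningFinsets K V ρ ∩ Set.Iio E)
      (linearMatroid K E)✶.nonemptyIndepFinsets := fun _ hS =>
  (sdiff_mem_nonemptyIndepFinsets_iff (le_of_lt hS.2)).2 ⟨ne_of_lt hS.2, hS.1.2.trans hE.2.symm⟩

theorem mapsTo_sdiff_nonemptyIndepFinsets {ρ : ℕ∞} {E : Finset V}
    (hE : E ∈ spanningFinsets K V ρ) :
    Set.MapsTo (E \ ·) (linearMatroid K E)✶.nonemptyIndepFinsets
      (spanningFinsets K V ρ ∩ Set.Iio E) := by
  intro F hF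
  have hFE : F ⊆ E := Finset.coe_subset.1 hF.2.subset_ground
  have h := hF
  rw [← Finset.sdiff_sdiff_eq_self hFE,
    sdiff_mem_nonemptyIndepFinsets_iff Finset.sdiff_subset] at h
  exact ⟨⟨fun h0 => hE.1 (Finset.sdiff_subset h0), h.2.trans hE.2⟩,
    lt_of_le_of_ne Finset.sdiff_subset h.1⟩

theorem cocyclesTrivial_spanningFinsets_Iio {ρ : ℕ∞} {E : Finset V}
    (hE : E ∈ spanningFinsets K V ρ) (h : 3 ≤ (linearMatroid K E)✶.eRank) :
    CocyclesTrivial (spanningFinsets K V ρ ∩ Set.Iio E) :=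
  (Matroid.cocyclesTrivial_nonemptyIndepFinsets h).of_antitone (E \ ·) (E \ ·)
    (mapsTo_sdiff_spanningFinsets hE) (mapsTo_sdiff_nonemptyIndepFinsets hE)
    (fun _ _ _ _ hxy => Finset.sdiff_subset_sdiff subset_rfl hxy)
    (fun _ _ _ _ hxy => Finset.sdiff_subset_sdiff subset_rfl hxy)
    (fun _ hS => Finset.sdiff_sdiff_eq_self (le_of_lt hS.2))

theorem orderConnected_spanningFinsets_Iio {ρ : ℕ∞} {E : Finset V}
    (hE : E ∈ spanningFinsets K V ρ) (h : 2 ≤ (linearMatroid K E)✶.eRank) :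
    OrderConnected (spanningFinsets K V ρ ∩ Set.Iio E) :=
  (Matroid.orderConnected_nonemptyIndepFinsets h).of_antitone (E \ ·) (E \ ·)
    (mapsTo_sdiff_spanningFinsets hE) (mapsTo_sdiff_nonemptyIndepFinsets hE)
    (fun _ _ _ _ hxy => Finset.sdiff_subset_sdiff subset_rfl hxy)
    (fun _ hS => Finset.sdiff_sdiff_eq_self (le_of_lt hS.2))

end LinearMatroid

/-! ### The poset of regular matroids -/

/-- The rank of the dual is the corank, since the two ranks add up to the size of `E`. -/
theorem three_le_eRank_dual_of_not_isRegular {V : Type*} [AddCommGroup V] [Module (ZMod 2) V]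
    {E : Finset V} (h : ¬ (linearMatroid (ZMod 2) E).IsRegular) :
    3 ≤ (linearMatroid (ZMod 2) E)✶.eRank := by
  have h1 := mt (linearMatroid_isRegular_of_encard_le E) h
  have h2 := (linearMatroid (ZMod 2) E).eRank_add_eRank_dual
  rw [linearMatroid_ground] at h2
  rw [not_le, ← h2, ENat.add_lt_add_iff_left
    ((Matroid.eRank_ne_top_iff _).2 inferInstance)] at h1
  exact Order.add_one_le_of_lt h1

theorem isGreatest_spanningFinsets (r : ℕ) :
    IsGreatest (spanningFinsets (ZMod 2) (Fin r → ZMod 2) r) (Finset.univ.erase 0) := by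
  refine ⟨⟨by simp, le_antisymm ?_ ?_⟩, fun E hE x hx => ?_⟩
  · obtain ⟨B, hB⟩ := (linearMatroid (ZMod 2) (Finset.univ.erase (0 : Fin r → ZMod 2))).exists_isBase
    rw [← hB.encard_eq_eRank]
    have h := ((linearMatroid_indep_iff _ B).1 hB.indep).2
    have := h.encard_le_toENat_rank
    simpa using this
  · have hli := (Pi.basisFun (ZMod 2) (Fin r)).linearIndependent
    have hind : (linearMatroid (ZMod 2) (Finset.univ.erase (0 : Fin r → ZMod 2))).Indep
        (Set.range (Pi.basisFun (ZMod 2) (Fin r))) := by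
      refine (linearMatroid_indep_iff _ _).2 ⟨?_, hli.linearIndepOn_id⟩
      rintro _ ⟨i, rfl⟩
      simp
    have := hind.encard_le_eRank
    rwa [← Set.image_univ, hli.injective.encard_image, Set.encard_univ, ENat.card_eq_coe_fintype_card,
      Fintype.card_fin] at this
  · refine Finset.mem_erase.2 ⟨?_, Finset.mem_univ x⟩
    rintro rfl
    exact hE.1 hx

/-- A basis of the ambient space has corank zero, hence is regular. -/
theorem IR_nonempty (r : ℕ) : Nonempty (IR r) := by
  classical
  have hT := (isGreatest_spanningFinsets r).1
  obtain ⟨B, hB⟩ := (linearMatroid (ZMod 2) (Finset.univ.erase (0 : Fin r → ZMod 2))).exists_isBase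
  obtain ⟨B, rfl⟩ : ∃ B' : Finset (Fin r → ZMod 2), (B' : Set _) = B :=
    ⟨B.toFinset, by simp⟩
  have hBT : B ⊆ Finset.univ.erase 0 := Finset.coe_subset.1 hB.subset_ground
  have hrank := (linearMatroid_spanning_iff hBT).1 hB.spanning
  refine ⟨B, fun h => by simpa using hBT h, linearMatroid_isRegular_of_encard_le B ?_,
    hrank.trans hT.2⟩
  rw [hrank, hB.encard_eq_eRank]
  exact le_self_add

theorem mainTheorem1 (r : ℕ) (hr : 1 ≤ r) : SimplyConnectedSpace (orderRealization (IR r)) := by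
  have := IR_nonempty r
  let Q := spanningFinsets (ZMod 2) (Fin r → ZMod 2) r
  let D : Set (Finset (Fin r → ZMod 2)) := {E | 0 ∉ E ∧ (linearMatroid (ZMod 2) E).IsRegular ∧
    (linearMatroid (ZMod 2) E).eRank = r}
  have hDQ : D ⊆ Q := fun E hE => ⟨hE.1, hE.2.2⟩
  have hD : ∀ a ∈ Q, ∀ b ∈ D, a ≤ b → a ∈ D := fun a ha b hb hab =>
    ⟨ha.1, hb.2.1.linearMatroid_mono hab, ha.2⟩
  have hT := isGreatest_spanningFinsets r
  have hlink : ∀ D', D ⊆ D' → ∀ E ∈ Q, E ∉ D' → 3 ≤ (linearMatroid (ZMod 2) E)✶.eRank :=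
    fun D' hDD' E hE hED => three_le_eRank_dual_of_not_isRegular fun h =>
      hED (hDD' ⟨hE.1, h, hE.2⟩)
  refine orderRealization.simplyConnectedSpace (OrderConnected.univ_subtype ?_)
    (CocyclesTrivial.univ_subtype ?_)
  -- The guard `D ⊆ D'` ensures that each removed `E` lies outside `D`, hence is nonregular.
  · refine lowerSet_induction (p := fun D' => D ⊆ D' → OrderConnected D') Q.toFinite
      (fun _ => .of_isGreatest hT) (fun D' E hDQ' hD' hE hED hlt h hDD' => ?_) hDQ hD subset_rfl
    exact .of_insert hDQ' hD' hE hED hlt (orderConnected_spanningFinsets_Iio hE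
      (le_trans (by norm_num) (hlink D' hDD' E hE hED))) (h (hDD'.trans (Set.subset_insert _ _)))
  · refine lowerSet_induction (p := fun D' => D ⊆ D' → CocyclesTrivial D') Q.toFinite
      (fun _ => .of_isGreatest hT) (fun D' E hDQ' hD' hE hED hlt h hDD' => ?_) hDQ hD subset_rfl
    exact .of_insert hDQ' hD' hE hED hlt (cocyclesTrivial_spanningFinsets_Iio hE
      (hlink D' hDD' E hE hED)) (h (hDD'.trans (Set.subset_insert _ _)))
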